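/- For $\ell\ge 1$ let $\Gamma_\ell(x)=\int_x^\infty t^{\ell-1}e^{-t}\,dt$ $(x\in\mathbb R)$. Let $k\ge 1$ be an integer and let $\theta=(\theta_1,\dots,\theta_k)\in\mathbb R^k$ have nonzero entries. A solution of the system $\mathrm{NLS}_k(\theta)$ is a tuple $(y_1,\dots,y_k)$ of continuous functions $y_j:[0,1)\to(0,\infty)$ such that each $t\mapsto\Gamma_k(-\ln y_j(t))$ is differentiable on $[0,1)$ (from the right at $0$) and, on $[0,1)$, $$(\Gamma_k(-\ln y_k))'=k!\Big(1-\frac1{k\theta_k}\Big)-\Gamma_{k+1}(-\ln y_k),$$ $$(\Gamma_k(-\ln y_j))'=k!-\Gamma_{k+1}(-\ln y_j)-\frac{\theta_{j+1}}{\theta_j}\big(k!-\Gamma_{k+1}(-\ln y_{j+1})\big)\quad(1\le j\le k-1),$$ $$y_j(0)=1,\qquad \lim_{t\uparrow1}y_j(t)=0\qquad(1\le j\le k).$$ Then, for every integer $k\ge1$: (i) there exists $\theta^\star$ for which $\mathrm{NLS}_k(\theta^\star)$ has a solution $(Y_1,\dots,Y_k)$, with every $Y_j$ differentiable on $(0,1)$;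 (ii) every $\theta^\star$ for which $\mathrm{NLS}_k(\theta^\star)$ has a solution satisfies $0<\theta_1^\star<\theta_2^\star<\cdots<\theta_k^\star<1/k$; (iii) for every solution $(Y_1,\dots,Y_k)$ of $\mathrm{NLS}_k(\theta^\star)$ and every $j\in\{1,\dots,k\}$, the function $Y_j$ is non-increasing on $[0,1)$. -/

import Mathlib

open Set Filter Topology
open scoped Nat

noncomputable section

/-- The upper incomplete gamma function `Γ_ℓ(x) = ∫_x^∞ t^(ℓ-1) e^(-t) dt`, for an integer `ℓ ≥ 1`
and any real `x`. -/
def upperGamma (l : ℕ) (x : ℝ) : ℝ :=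
  ∫ t in Ioi x, t ^ (l - 1) * Real.exp (-t)

/-- `y = (y_1, …, y_k)` is a solution on `[0, 1)` of the nonlinear system with parameter vector
`θ = (θ_1, …, θ_k)`. The indices `1, …, k` are represented by `Fin k`, so that the last index `k`
is the `j` with `j + 1 = k`. Only the values of the `y_j` on `[0, 1)` matter.
The derivative at `0` is the right derivative. -/
structure IsNLSSolution (k : ℕ) (θ : Fin k → ℝ) (y : Fin k → ℝ → ℝ) : Prop where
  /-- the quotients in the equations are meaningful -/
  theta_ne_zero : ∀ j, θ j ≠ 0
  /-- the logarithms in the equations are meaningful -/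
  pos : ∀ j, ∀ t ∈ Ico (0 : ℝ) 1, 0 < y j t
  continuousOn : ∀ j, ContinuousOn (y j) (Ico 0 1)
  /-- `(Γ_k(-ln y_k))' = k! (1 - 1/(k θ_k)) - Γ_{k+1}(-ln y_k)` on `[0, 1)` -/
  ode_last : ∀ j : Fin k, (j : ℕ) + 1 = k → ∀ t ∈ Ico (0 : ℝ) 1,
    HasDerivWithinAt (fun s => upperGamma k (-Real.log (y j s)))
      ((k ! : ℝ) * (1 - 1 / ((k : ℝ) * θ j)) - upperGamma (k + 1) (-Real.log (y j t)))
      (Ico 0 1) t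
  /-- `(Γ_k(-ln y_j))' = k! - Γ_{k+1}(-ln y_j) - (θ_{j+1}/θ_j) (k! - Γ_{k+1}(-ln y_{j+1}))`
  on `[0, 1)` for `j < k`; here `j'` is the index `j + 1` -/
  ode_step : ∀ j j' : Fin k, (j' : ℕ) = (j : ℕ) + 1 → ∀ t ∈ Ico (0 : ℝ) 1,
    HasDerivWithinAt (fun s => upperGamma k (-Real.log (y j s)))
      ((k ! : ℝ) - upperGamma (k + 1) (-Real.log (y j t))
        - θ j' / θ j * ((k ! : ℝ) - upperGamma (k + 1) (-Real.log (y j' t))))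
      (Ico 0 1) t
  init : ∀ j, y j 0 = 1
  terminal : ∀ j, Tendsto (y j) (𝓝[<] 1) (𝓝 0)

end

/-! Put `n = k - 1`, `x_j = -ln y_j` and `u_j = lowerGamma n x_j`. Each equation becomes `u' = d * p
- lowerGamma (n + 1) x`. For the last index `p` is the constant `(n + 1)!` and `d = 1 / (k θ_k)`;
for `j < k`, `p` is the outflow `lowerGamma (n + 1) x_{j+1}` of the next component and `d = θ_{j+1}
/ θ_j`. The system is therefore triangular and is treated one component at a time, from `j = k`
downwards. The induction runs because the outflow of a component inherits from its inflow the
properties in `IsInflow` (`IsComponent.isInflow`).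

The inequalities on `θ` amount to `d > 1` for every component (`IsComponent.one_lt_coeff`). If `d ≤
1`, the gap `w = n! - u` satisfies `w' ≥ -(A - 2 log w) w`. This is an Osgood-type bound, so `w`
stays positive in finite time, whereas the terminal condition requires `w → 0` at time `1`.
Monotonicity of `y_j` comes from comparing `u` with its own time shifts.

For existence, the outflow is a continuous nondecreasing function of `u`, so solutions depend
Lipschitz-continuously on `d`. The intermediate value theorem gives a `d` for which `u` equals `n!`
at time `1` (`exists_coeff_outflow_solution`), and the same Osgood bound excludes an earlier arrival
(`lt_factorial_of_outflow_solution`). The parameters `θ_j` are recovered from the products of the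
factors `d`. -/

/-! ### Incomplete gamma integrals: signs, comparisons and tail bounds. -/

/-- The lower incomplete gamma integral `∫_0^x t^n e^(-t) dt`. -/
noncomputable def lowerGamma (n : ℕ) (x : ℝ) : ℝ := ∫ t in (0 : ℝ)..x, t ^ n * Real.exp (-t)

theorem hasDerivAt_lowerGamma (n : ℕ) (x : ℝ) :
    HasDerivAt (lowerGamma n) (x ^ n * Real.exp (-x)) x := by
  have hc : Continuous fun t : ℝ => t ^ n * Real.exp (-t) := by fun_prop
  exact intervalIntegral.integral_hasDerivAt_right (hc.intervalIntegrable _ _)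
    (hc.stronglyMeasurableAtFilter _ _) hc.continuousAt

theorem continuous_lowerGamma (n : ℕ) : Continuous (lowerGamma n) :=
  continuous_iff_continuousAt.2 fun x => (hasDerivAt_lowerGamma n x).continuousAt

@[simp] theorem lowerGamma_zero (n : ℕ) : lowerGamma n 0 = 0 := by simp [lowerGamma]

theorem integrableOn_pow_mul_exp_neg (n : ℕ) :
    MeasureTheory.IntegrableOn (fun t : ℝ => t ^ n * Real.exp (-t)) (Ioi 0) := by
  have h := Real.GammaIntegral_convergent (s := (n : ℝ) + 1) (by positivity)
  refine h.congr_fun (fun t _ => ?_) measurableSet_Ioi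
  simp [mul_comm]

theorem integral_pow_mul_exp_neg (n : ℕ) :
    ∫ t in Ioi (0 : ℝ), t ^ n * Real.exp (-t) = (n ! : ℝ) := by
  rw [← Real.Gamma_nat_eq_factorial, Real.Gamma_eq_integral (by positivity)]
  refine MeasureTheory.setIntegral_congr_fun measurableSet_Ioi fun t _ => ?_
  simp [mul_comm]

theorem upperGamma_succ (n : ℕ) (x : ℝ) : upperGamma (n + 1) x = (n ! : ℝ) - lowerGamma n x := by
  have hc : Continuous fun t : ℝ => t ^ n * Real.exp (-t) := by fun_prop
  have hx : MeasureTheory.IntegrableOn (fun t : ℝ => t ^ n * Real.exp (-t)) (Ioi x) := by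
    have h1 : MeasureTheory.IntegrableOn (fun t : ℝ => t ^ n * Real.exp (-t)) (Icc x 0) :=
      hc.continuousOn.integrableOn_Icc
    refine (h1.union (integrableOn_pow_mul_exp_neg n)).mono_set fun t ht => ?_
    rcases le_or_gt t 0 with h | h
    · exact Or.inl ⟨le_of_lt ht, h⟩
    · exact Or.inr h
  have h := intervalIntegral.integral_interval_add_Ioi (integrableOn_pow_mul_exp_neg n) hx
  rw [integral_pow_mul_exp_neg] at h
  rw [upperGamma, lowerGamma, Nat.add_sub_cancel]
  linarith

theorem tendsto_lowerGamma_atTop (n : ℕ) : Tendsto (lowerGamma n) atTop (𝓝 (n ! : ℝ)) := by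
  rw [← integral_pow_mul_exp_neg n]
  exact MeasureTheory.intervalIntegral_tendsto_integral_Ioi 0 (integrableOn_pow_mul_exp_neg n)
    tendsto_id

theorem strictMonoOn_lowerGamma (n : ℕ) : StrictMonoOn (lowerGamma n) (Ici 0) := by
  refine strictMonoOn_of_hasDerivWithinAt_pos (convex_Ici 0) (continuous_lowerGamma n).continuousOn
    (fun x _ => (hasDerivAt_lowerGamma n x).hasDerivWithinAt) fun x hx => ?_
  rw [interior_Ici] at hx
  have : (0 : ℝ) < x := hx
  positivity

theorem lowerGamma_nonneg (n : ℕ) {x : ℝ} (hx : 0 ≤ x) : 0 ≤ lowerGamma n x := by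
  simpa using (strictMonoOn_lowerGamma n).monotoneOn (mem_Ici.2 le_rfl) hx hx

theorem lowerGamma_pos (n : ℕ) {x : ℝ} (hx : 0 < x) : 0 < lowerGamma n x := by
  simpa using strictMonoOn_lowerGamma n (mem_Ici.2 le_rfl) hx.le hx

theorem lowerGamma_lt_factorial (n : ℕ) {x : ℝ} (hx : 0 ≤ x) : lowerGamma n x < (n ! : ℝ) := by
  have h1 : lowerGamma n x < lowerGamma n (x + 1) :=
    strictMonoOn_lowerGamma n hx (mem_Ici.2 (by linarith)) (by linarith)
  refine h1.trans_le (ge_of_tendsto (tendsto_lowerGamma_atTop n) ?_)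
  filter_upwards [eventually_ge_atTop (x + 1)] with y hy
  exact (strictMonoOn_lowerGamma n).monotoneOn (mem_Ici.2 (by linarith))
    (mem_Ici.2 (by linarith)) hy

theorem lowerGamma_pos_of_neg_of_odd {n : ℕ} (hn : Odd n) {x : ℝ} (hx : x < 0) :
    0 < lowerGamma n x := by
  have : StrictAntiOn (lowerGamma n) (Iic 0) := by
    refine strictAntiOn_of_hasDerivWithinAt_neg (convex_Iic 0)
      (continuous_lowerGamma n).continuousOn
      (fun x _ => (hasDerivAt_lowerGamma n x).hasDerivWithinAt) fun x hx => ?_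
    rw [interior_Iic] at hx
    exact mul_neg_of_neg_of_pos (hn.pow_neg hx) (Real.exp_pos _)
  simpa using this hx.le (mem_Iic.2 le_rfl) hx

theorem lowerGamma_neg_of_neg_of_even {n : ℕ} (hn : Even n) {x : ℝ} (hx : x < 0) :
    lowerGamma n x < 0 := by
  have : StrictMonoOn (lowerGamma n) (Iic 0) := by
    refine strictMonoOn_of_hasDerivWithinAt_pos (convex_Iic 0)
      (continuous_lowerGamma n).continuousOn
      (fun x _ => (hasDerivAt_lowerGamma n x).hasDerivWithinAt) fun x hx => ?_
    rw [interior_Iic] at hx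
    exact mul_pos (hn.pow_pos (ne_of_lt hx)) (Real.exp_pos _)
  simpa using this hx.le (mem_Iic.2 le_rfl) hx

/-- The two integrands differ by the factor `t ≥ -M`, and `t ^ n` is nonnegative for even `n`. This
linear bound serves to exclude negative excursions of a component. -/
theorem lowerGamma_succ_le_of_even {n : ℕ} (hn : Even n) {M x : ℝ} (hM : -M ≤ x) (hx : x ≤ 0) :
    lowerGamma (n + 1) x ≤ -M * lowerGamma n x := by
  have : MonotoneOn (fun t => lowerGamma (n + 1) t + M * lowerGamma n t) (Icc (-M) 0) := by
    refine monotoneOn_of_hasDerivWithinAt_nonneg (convex_Icc _ _)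
      ((continuous_lowerGamma _).add
        (continuous_const.mul (continuous_lowerGamma n))).continuousOn
      (fun x _ => ((hasDerivAt_lowerGamma (n + 1) x).add
        ((hasDerivAt_lowerGamma n x).const_mul M)).hasDerivWithinAt) fun x hx => ?_
    rw [interior_Icc] at hx
    have h1 : 0 ≤ x ^ n * Real.exp (-x) := mul_nonneg (hn.pow_nonneg x) (Real.exp_pos _).le
    have h2 : 0 ≤ x + M := by linarith [hx.1]
    calc (0 : ℝ) ≤ (x ^ n * Real.exp (-x)) * (x + M) := mul_nonneg h1 h2
      _ = _ := by ring
  have := this ⟨hM, hx⟩ (right_mem_Icc.2 (hM.trans hx)) hx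
  simp only [lowerGamma_zero] at this
  linarith

/-- The quotient of the integrands is `t ≤ N`. Thus `lowerGamma (n + 1) x`, viewed as a function of
`lowerGamma n x`, has slope `x`: it is Lipschitz below each level `lowerGamma n N`, but not up to
`n!`. -/
theorem lowerGamma_succ_sub_le (n : ℕ) {N a b : ℝ} (ha : 0 ≤ a) (hab : a ≤ b) (hb : b ≤ N) :
    lowerGamma (n + 1) b - lowerGamma (n + 1) a ≤ N * (lowerGamma n b - lowerGamma n a) := by
  have : MonotoneOn (fun t => N * lowerGamma n t - lowerGamma (n + 1) t) (Icc 0 N) := by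
    refine monotoneOn_of_hasDerivWithinAt_nonneg (convex_Icc _ _)
      ((continuous_const.mul (continuous_lowerGamma n)).sub
        (continuous_lowerGamma _)).continuousOn
      (fun x _ => (((hasDerivAt_lowerGamma n x).const_mul N).sub
        (hasDerivAt_lowerGamma (n + 1) x)).hasDerivWithinAt) fun x hx => ?_
    rw [interior_Icc] at hx
    have h0 := hx.1
    have h1 : 0 ≤ x ^ n * Real.exp (-x) := by positivity
    have h2 : 0 ≤ N - x := by linarith [hx.2]
    calc (0 : ℝ) ≤ (x ^ n * Real.exp (-x)) * (N - x) := mul_nonneg h1 h2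
      _ = _ := by ring
  have := this ⟨ha, hab.trans hb⟩ ⟨ha.trans hab, hb⟩ hab
  simp only at this
  linarith

theorem lowerGamma_succ_eq (n : ℕ) (x : ℝ) :
    lowerGamma (n + 1) x = (n + 1) * lowerGamma n x - x ^ (n + 1) * Real.exp (-x) := by
  have hd : ∀ x : ℝ, HasDerivAt (fun t => lowerGamma (n + 1) t -
      ((n + 1) * lowerGamma n t - t ^ (n + 1) * Real.exp (-t))) 0 x := by
    intro x
    have h1 : HasDerivAt (fun t : ℝ => t ^ (n + 1) * Real.exp (-t))
        (((n + 1 : ℕ) : ℝ) * x ^ n * Real.exp (-x) + x ^ (n + 1) * (Real.exp (-x) * -1)) x :=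
      (hasDerivAt_pow (n + 1) x).mul ((hasDerivAt_neg x).exp)
    refine ((hasDerivAt_lowerGamma (n + 1) x).sub
      (((hasDerivAt_lowerGamma n x).const_mul ((n : ℝ) + 1)).sub h1)).congr_deriv ?_
    push_cast
    ring
  have := is_const_of_deriv_eq_zero (fun x => (hd x).differentiableAt) (fun x => (hd x).deriv) x 0
  simp at this
  linarith

theorem factorial_sub_lowerGamma_zero (x : ℝ) :
    ((0 ! : ℕ) : ℝ) - lowerGamma 0 x = Real.exp (-x) := by
  simp [lowerGamma]

theorem factorial_sub_lowerGamma_succ (n : ℕ) (x : ℝ) :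
    (((n + 1)! : ℕ) : ℝ) - lowerGamma (n + 1) x =
      (n + 1) * ((n ! : ℝ) - lowerGamma n x) + x ^ (n + 1) * Real.exp (-x) := by
  rw [lowerGamma_succ_eq, Nat.factorial_succ]
  push_cast
  ring

theorem pow_mul_exp_neg_le (n : ℕ) {x : ℝ} (hx : 0 ≤ x) :
    x ^ n * Real.exp (-x) ≤ (n ! : ℝ) - lowerGamma n x := by
  cases n with
  | zero => rw [factorial_sub_lowerGamma_zero]; simp
  | succ n =>
    rw [factorial_sub_lowerGamma_succ]
    have := lowerGamma_lt_factorial n hx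
    have : 0 ≤ ((n : ℝ) + 1) * ((n ! : ℝ) - lowerGamma n x) :=
      mul_nonneg (by positivity) (by linarith)
    linarith

/-- Half of the exponential decay is given up to absorb the powers of `x`. Only the logarithm of the
bound matters later; the rate `1/2` produces the factor `2` in front of the logarithms below. -/
theorem exists_factorial_sub_lowerGamma_le (n : ℕ) :
    ∃ C : ℝ, 0 < C ∧ ∀ x : ℝ, 0 ≤ x → (n ! : ℝ) - lowerGamma n x ≤ C * Real.exp (-(x / 2)) := by
  induction n with
  | zero =>
    refine ⟨1, one_pos, fun x hx => ?_⟩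
    rw [factorial_sub_lowerGamma_zero, one_mul]
    exact Real.exp_le_exp.2 (by linarith)
  | succ n ih =>
    obtain ⟨C, hC, h⟩ := ih
    refine ⟨(n + 1) * C + 2 ^ (n + 1) * ((n + 1)! : ℕ), by positivity, fun x hx => ?_⟩
    rw [factorial_sub_lowerGamma_succ]
    have h1 := Real.pow_div_factorial_le_exp (x / 2) (by positivity) (n + 1)
    rw [div_le_iff₀ (by positivity), div_pow, div_le_iff₀ (by positivity)] at h1
    have h2 : x ^ (n + 1) * Real.exp (-x) ≤
        2 ^ (n + 1) * ((n + 1)! : ℕ) * Real.exp (-(x / 2)) := by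
      calc x ^ (n + 1) * Real.exp (-x)
          ≤ (Real.exp (x / 2) * ((n + 1)! : ℕ) * 2 ^ (n + 1)) * Real.exp (-x) := by gcongr
        _ = 2 ^ (n + 1) * ((n + 1)! : ℕ) * (Real.exp (x / 2) * Real.exp (-x)) := by ring
        _ = _ := by rw [← Real.exp_add]; ring_nf
    have h3 := mul_le_mul_of_nonneg_left (h x hx) (by positivity : (0 : ℝ) ≤ n + 1)
    linarith

/-- With `w` the tail of order `n`, integration by parts bounds the next tail by `(n + 1 + x) * w`,
and exponential decay of `w` gives `x ≤ 2 log C - 2 log w`. -/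
theorem exists_factorial_sub_lowerGamma_succ_le (n : ℕ) :
    ∃ A : ℝ, ∀ x : ℝ, 0 ≤ x → ((n + 1)! : ℕ) - lowerGamma (n + 1) x ≤
      (A - 2 * Real.log ((n ! : ℝ) - lowerGamma n x)) * ((n ! : ℝ) - lowerGamma n x) := by
  obtain ⟨C, hC, h⟩ := exists_factorial_sub_lowerGamma_le n
  refine ⟨n + 1 + 2 * Real.log C, fun x hx => ?_⟩
  have hpos : 0 < (n ! : ℝ) - lowerGamma n x := by linarith [lowerGamma_lt_factorial n hx]
  have h1 : Real.log ((n ! : ℝ) - lowerGamma n x) ≤ Real.log C - x / 2 := by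
    have := Real.log_le_log hpos (h x hx)
    rwa [Real.log_mul hC.ne' (Real.exp_pos _).ne', Real.log_exp, ← sub_eq_add_neg] at this
  rw [factorial_sub_lowerGamma_succ]
  have h2 := mul_le_mul_of_nonneg_left (pow_mul_exp_neg_le n hx) hx
  have h3 : x * ((n ! : ℝ) - lowerGamma n x) ≤
      (2 * Real.log C - 2 * Real.log ((n ! : ℝ) - lowerGamma n x)) *
        ((n ! : ℝ) - lowerGamma n x) :=
    mul_le_mul_of_nonneg_right (by linarith) hpos.le
  rw [pow_succ]
  nlinarith

/-! ### Scalar differential inequalities and first or last zeros. -/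

theorem HasDerivWithinAt.Ici_of_Ico {f : ℝ → ℝ} {f' a b t : ℝ}
    (h : HasDerivWithinAt f f' (Ico a b) t) (ht : t ∈ Ico a b) : HasDerivWithinAt f f' (Ici t) t :=
  h.mono_of_mem_nhdsWithin
    (mem_of_superset (Ico_mem_nhdsGE ht.2) (Ico_subset_Ico_left ht.1))

/-- If the right derivative of `w` is at most `C` wherever `w > 0`, then `w` grows at most with
slope `C` from any nonnegative bound on its initial value. -/
theorem le_add_mul_of_deriv_right_le_of_pos {w w' : ℝ → ℝ} {a b A C : ℝ} (hA : 0 ≤ A) (hC : 0 ≤ C)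
    (hc : ContinuousOn w (Icc a b)) (hd : ∀ t ∈ Ico a b, HasDerivWithinAt w (w' t) (Ici t) t)
    (ha : w a ≤ A) (hle : ∀ t ∈ Ico a b, 0 < w t → w' t ≤ C) :
    ∀ t ∈ Icc a b, w t ≤ A + C * (t - a) := by
  intro t ht
  -- The slack `η` makes the barrier strictly positive and its slope strictly larger than `C`, so
  -- the derivative bound is available at any contact point.
  have key : ∀ η : ℝ, 0 < η → w t ≤ A + C * (t - a) + η * (1 + (t - a)) := by
    intro η hη
    have hB : ∀ x : ℝ, HasDerivAt (fun x => A + C * (x - a) + η * (1 + (x - a))) (C + η) x := by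
      intro x
      have h1 : HasDerivAt (fun x : ℝ => x - a) 1 x := (hasDerivAt_id x).sub_const a
      exact (((h1.const_mul C).const_add A).add ((h1.const_add 1).const_mul η)).congr_deriv
        (by ring)
    refine image_le_of_deriv_right_lt_deriv_boundary hc hd ?_ hB ?_ ht
    · simp only [sub_self]
      linarith
    · intro x hx hw
      have hxa : 0 ≤ x - a := by linarith [hx.1]
      have : 0 < w x := by rw [hw]; positivity
      linarith [hle x hx this]
  have hlim : Tendsto (fun η : ℝ => A + C * (t - a) + η * (1 + (t - a))) (𝓝[>] 0)
      (𝓝 (A + C * (t - a) + 0 * (1 + (t - a)))) :=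
    ((continuous_const.add (continuous_id.mul continuous_const)).tendsto 0).mono_left
      nhdsWithin_le_nhds
  rw [zero_mul, add_zero] at hlim
  exact ge_of_tendsto hlim (eventually_mem_nhdsWithin.mono fun η hη => key η hη)

/-- A function with `w' ≥ -(A - 2 log w) w` does not reach `0` in finite time. -/
theorem not_tendsto_zero_of_deriv_ge {w w' : ℝ → ℝ} {T A : ℝ} (hT : 0 < T)
    (hpos : ∀ t ∈ Ico 0 T, 0 < w t)
    (hd : ∀ t ∈ Ico 0 T, HasDerivWithinAt w (w' t) (Ico 0 T) t)
    (hw : ∀ t ∈ Ico 0 T, -((A - 2 * Real.log (w t)) * w t) ≤ w' t) :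
    ¬ Tendsto w (𝓝[<] T) (𝓝 0) := by
  intro hlim
  -- The quantity `v = A - 2 log w` satisfies `v' ≤ 2 v`, so `v * exp (-2 t)` decreases and `log w`
  -- is bounded below.
  set g : ℝ → ℝ := fun t => (A - 2 * Real.log (w t)) * Real.exp (-2 * t) with hg
  have hgd : ∀ t ∈ Ico 0 T, HasDerivWithinAt g
      ((0 - 2 * (w' t / w t)) * Real.exp (-2 * t) +
        (A - 2 * Real.log (w t)) * (Real.exp (-2 * t) * (-2 * 1))) (Ico 0 T) t := by
    intro t ht
    exact ((hasDerivWithinAt_const _ _ _).sub (((hd t ht).log (hpos t ht).ne').const_mul 2)).mul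
      (((hasDerivWithinAt_id _ _).const_mul (-2)).exp)
  have hanti : AntitoneOn g (Ico 0 T) := by
    refine antitoneOn_of_hasDerivWithinAt_nonpos (convex_Ico 0 T)
      (fun t ht => (hgd t ht).continuousWithinAt)
      (fun t ht => (hgd t (interior_subset ht)).mono interior_subset) fun t ht => ?_
    have ht' := interior_subset ht
    have h1 : -(A - 2 * Real.log (w t)) ≤ w' t / w t := by
      rw [le_div_iff₀ (hpos t ht')]
      linarith [hw t ht']
    have h2 := Real.exp_pos (-2 * t)
    nlinarith
  have h0 : (0 : ℝ) ∈ Ico 0 T := ⟨le_rfl, hT⟩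
  have hbound : ∀ t ∈ Ico 0 T, A - 2 * Real.log (w t) ≤ |g 0| * Real.exp (2 * T) := by
    intro t ht
    have h1 : g t ≤ |g 0| := (hanti h0 ht ht.1).trans (le_abs_self _)
    calc A - 2 * Real.log (w t) = g t * Real.exp (2 * t) := by
          rw [hg]
          simp only
          rw [mul_assoc, ← Real.exp_add]
          simp
      _ ≤ |g 0| * Real.exp (2 * t) := by gcongr
      _ ≤ |g 0| * Real.exp (2 * T) := by
          have := ht.2.le
          gcongr
  have hmem : ∀ᶠ t in 𝓝[<] T, t ∈ Ico 0 T := Ico_mem_nhdsLT hT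
  have hlog : Tendsto (fun t => Real.log (w t)) (𝓝[<] T) atBot := by
    refine Real.tendsto_log_nhdsGT_zero.comp (tendsto_nhdsWithin_iff.2 ⟨hlim, ?_⟩)
    filter_upwards [hmem] with t ht using hpos t ht
  obtain ⟨t, ht, h⟩ := (hmem.and
    (hlog.eventually_lt_atBot ((A - |g 0| * Real.exp (2 * T)) / 2))).exists
  linarith [hbound t ht]

/-- Solutions of `u' = f - q`, where `f` is monotone in time and `q` is a monotone function of `u`,
are monotone if they start at their minimum. -/
theorem monotoneOn_of_deriv_eq_sub {u f q : ℝ → ℝ} {b : ℝ}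
    (hd : ∀ t ∈ Ico 0 b, HasDerivWithinAt u (f t - q t) (Ico 0 b) t)
    (hf : MonotoneOn f (Ico 0 b))
    (hq : ∀ s ∈ Ico 0 b, ∀ t ∈ Ico 0 b, u t < u s → q t ≤ q s)
    (h0 : ∀ t ∈ Ico 0 b, u 0 ≤ u t) : MonotoneOn u (Ico 0 b) := by
  intro s hs t ht hst
  have hcu : ContinuousOn u (Ico 0 b) := fun r hr => (hd r hr).continuousWithinAt
  have hr1 : ∀ r ∈ Icc 0 s, r ∈ Ico 0 b := fun r hr => ⟨hr.1, hr.2.trans_lt hs.2⟩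
  have hr2 : ∀ r ∈ Icc 0 s, r + (t - s) ∈ Ico 0 b := fun r hr =>
    ⟨by linarith [hr.1], by linarith [hr.2, ht.2]⟩
  -- Compare `u` with its translate by `t - s`. The difference is nonpositive at time `0`, where `u`
  -- is minimal, and cannot increase while positive.
  have h := le_add_mul_of_deriv_right_le_of_pos (w := fun r => u r - u (r + (t - s)))
    (w' := fun r => (f r - q r) - (f (r + (t - s)) - q (r + (t - s))) * 1) (a := 0) (b := s)
    le_rfl le_rfl ?_ ?_ ?_ ?_ s (right_mem_Icc.2 hs.1)
  · simp only [add_sub_cancel, zero_mul, add_zero] at h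
    linarith
  · exact (hcu.mono hr1).sub (hcu.comp (by fun_prop) hr2)
  · intro r hr
    have hr' := Ico_subset_Icc_self hr
    have h1 := (hd r (hr1 r hr')).Ici_of_Ico (hr1 r hr')
    have h2 := (hd _ (hr2 r hr')).Ici_of_Ico (hr2 r hr')
    refine h1.sub (h2.comp r ((hasDerivWithinAt_id _ _).add_const _) fun y hy => ?_)
    simpa using hy
  · simp only [zero_add]
    linarith [h0 (t - s) ⟨by linarith, by linarith [ht.2, hs.1]⟩]
  · intro r hr hw
    have hr' := Ico_subset_Icc_self hr
    have h1 := hf (hr1 r hr') (hr2 r hr') (by linarith)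
    have h2 := hq r (hr1 r hr') _ (hr2 r hr') (by linarith)
    linarith

theorem exists_last_zero {x : ℝ → ℝ} {a b : ℝ} (hab : a ≤ b) (hc : ContinuousOn x (Icc a b))
    (ha : x a ≤ 0) (hb : 0 < x b) :
    ∃ s ∈ Ico a b, x s = 0 ∧ ∀ r ∈ Ioc s b, 0 < x r := by
  obtain ⟨s, ⟨hs, hxs⟩, hmax⟩ := ((isCompact_Icc (a := a) (b := b)).of_isClosed_subset
    (hc.preimage_isClosed_of_isClosed isClosed_Icc (isClosed_Iic (a := (0 : ℝ))))
    inter_subset_left).exists_isGreatest ⟨a, left_mem_Icc.2 hab, ha⟩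
  have hpos : ∀ r ∈ Ioc s b, 0 < x r := by
    intro r hr
    by_contra hneg
    exact absurd (hmax ⟨⟨hs.1.trans hr.1.le, hr.2⟩, not_lt.1 hneg⟩) (not_le.2 hr.1)
  have hsb : s < b := lt_of_le_of_ne hs.2 fun h => by
    rw [h] at hxs
    exact absurd hxs (not_le.2 hb)
  obtain ⟨r, hr, hr0⟩ := intermediate_value_Icc hs.2 (hc.mono (Icc_subset_Icc_left hs.1))
    ⟨hxs, hb.le⟩
  refine ⟨s, ⟨hs.1, hsb⟩, ?_, hpos⟩
  rcases hr.1.eq_or_lt with h | h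
  · rw [h, hr0]
  · exact absurd hr0 (hpos r ⟨h, hr.2⟩).ne'

theorem exists_first_zero {x : ℝ → ℝ} {a b : ℝ} (hab : a ≤ b) (hc : ContinuousOn x (Icc a b))
    (ha : x a < 0) (hb : 0 ≤ x b) :
    ∃ s ∈ Ioc a b, x s = 0 ∧ ∀ r ∈ Ico a s, x r < 0 := by
  obtain ⟨s, hs, h0, h⟩ := exists_last_zero (x := fun r => -x (-r)) (neg_le_neg hab)
    (hc.comp (by fun_prop) fun r hr => ⟨by linarith [hr.2], by linarith [hr.1]⟩).neg
    (by simpa using hb) (by simpa using ha)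
  refine ⟨-s, ⟨by linarith [hs.2], by linarith [hs.1]⟩, by simpa using h0, fun r hr => ?_⟩
  simpa using h (-r) ⟨by linarith [hr.2], by linarith [hr.1]⟩

/-! ### A single component: sign, monotonicity and size of its coefficient. -/

/-- The inflow `p` into one component of the system: monotone, bounded by `M`, and positive after
time `0`. -/
structure IsInflow (M : ℝ) (p : ℝ → ℝ) : Prop where
  mono : MonotoneOn p (Ico 0 1)
  nonneg : ∀ t ∈ Ico (0 : ℝ) 1, 0 ≤ p t
  pos : ∀ t ∈ Ioo (0 : ℝ) 1, 0 < p t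
  le : ∀ t ∈ Ico (0 : ℝ) 1, p t ≤ M

/-- `x` solves one equation of the system, in logarithmic coordinates, with inflow `d * p`. -/
structure IsComponent (n : ℕ) (d : ℝ) (p x : ℝ → ℝ) : Prop where
  continuousOn : ContinuousOn x (Ico 0 1)
  init : x 0 = 0
  terminal : Tendsto x (𝓝[<] 1) atTop
  ode : ∀ t ∈ Ico (0 : ℝ) 1, HasDerivWithinAt (fun s => lowerGamma n (x s))
    (d * p t - lowerGamma (n + 1) (x t)) (Ico 0 1) t

namespace IsComponent

variable {n : ℕ} {d : ℝ} {p x : ℝ → ℝ}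

theorem exists_pos_after (hx : IsComponent n d p x) {t : ℝ} (ht : t ∈ Ico (0 : ℝ) 1) :
    ∃ b ∈ Ioo t 1, 0 < x b :=
  ((show ∀ᶠ b in 𝓝[<] (1 : ℝ), b ∈ Ioo t 1 from Ioo_mem_nhdsLT ht.2).and
    (hx.terminal.eventually_gt_atTop 0)).exists

/-- If `d ≤ 0`, then after the last zero of `x` before a time with `x > 0`, `lowerGamma n x` starts
from `0` and cannot increase. -/
theorem coeff_pos (hx : IsComponent n d p x) (hp : IsInflow ((n + 1)! : ℕ) p) : 0 < d := by
  by_contra! hd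
  obtain ⟨b, hb, hxb⟩ := hx.exists_pos_after ⟨le_rfl, one_pos⟩
  have hsub : Icc 0 b ⊆ Ico (0 : ℝ) 1 := Icc_subset_Ico_right hb.2
  obtain ⟨s, hs, hs0, hpos⟩ := exists_last_zero hb.1.le (hx.continuousOn.mono hsub) hx.init.le hxb
  have hsub' : Icc s b ⊆ Ico (0 : ℝ) 1 := (Icc_subset_Icc_left hs.1).trans hsub
  have hanti : AntitoneOn (fun s => lowerGamma n (x s)) (Icc s b) := by
    refine antitoneOn_of_hasDerivWithinAt_nonpos (convex_Icc s b)
      (fun t ht => (hx.ode t (hsub' ht)).continuousWithinAt.mono hsub')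
      (fun t ht => (hx.ode t (hsub' (interior_subset ht))).mono
        (interior_subset.trans hsub')) fun t ht => ?_
    have ht' := hsub' (interior_subset ht)
    rw [interior_Icc] at ht
    have h1 := lowerGamma_pos (n + 1) (hpos t ⟨ht.1, ht.2.le⟩)
    have h2 := mul_nonpos_of_nonpos_of_nonneg hd (hp.nonneg t ht')
    linarith
  have h1 := hanti (left_mem_Icc.2 hs.2.le) (right_mem_Icc.2 hs.2.le) hs.2.le
  simp only [hs0, lowerGamma_zero] at h1
  linarith [lowerGamma_pos n hxb]

theorem nonneg (hx : IsComponent n d p x) (hp : IsInflow ((n + 1)! : ℕ) p) :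
    ∀ t ∈ Ico (0 : ℝ) 1, 0 ≤ x t := by
  have hd := hx.coeff_pos hp
  intro t ht
  by_contra! hneg
  -- For even `n`, `lowerGamma n x` is negative on a negative excursion, and a Grönwall argument
  -- from the preceding zero forbids this. For odd `n` it is positive there and nondecreasing, so it
  -- cannot return to `0` at the next zero.
  rcases Nat.even_or_odd n with hn | hn
  · have hsub : Icc 0 t ⊆ Ico (0 : ℝ) 1 := Icc_subset_Ico_right ht.2
    obtain ⟨s, hs, hs0, hxneg⟩ := exists_last_zero (x := fun r => -x r) ht.1
      (hx.continuousOn.mono hsub).neg (by simp [hx.init]) (by simpa using hneg)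
    simp only [neg_eq_zero, Left.neg_pos_iff] at hs0 hxneg
    have hsub' : Icc s t ⊆ Ico (0 : ℝ) 1 := (Icc_subset_Icc_left hs.1).trans hsub
    obtain ⟨m, hm⟩ := (isCompact_Icc (a := s) (b := t)).bddBelow_image
      (hx.continuousOn.mono hsub')
    have hmx : ∀ r ∈ Icc s t, m ≤ x r := fun r hr => hm (mem_image_of_mem x hr)
    have hder : ∀ r ∈ Icc s t, HasDerivWithinAt
        (fun r => lowerGamma n (x r) * Real.exp (m * r))
        ((d * p r - lowerGamma (n + 1) (x r)) * Real.exp (m * r) +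
          lowerGamma n (x r) * (Real.exp (m * r) * (m * 1))) (Icc s t) r := fun r hr =>
      ((hx.ode r (hsub' hr)).mono hsub').mul (((hasDerivWithinAt_id _ _).const_mul m).exp)
    have hmono : MonotoneOn (fun r => lowerGamma n (x r) * Real.exp (m * r)) (Icc s t) := by
      refine monotoneOn_of_hasDerivWithinAt_nonneg (convex_Icc s t)
        (fun r hr => (hder r hr).continuousWithinAt)
        (fun r hr => (hder r (interior_subset hr)).mono interior_subset) fun r hr => ?_
      have hr' := interior_subset hr
      rw [interior_Icc] at hr
      have h1 := lowerGamma_succ_le_of_even hn (M := -m) (by simpa using hmx r hr')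
        (hxneg r ⟨hr.1, hr.2.le⟩).le
      have h2 := mul_nonneg hd.le (hp.nonneg r (hsub' hr'))
      calc (0 : ℝ) ≤ (d * p r - lowerGamma (n + 1) (x r) + m * lowerGamma n (x r)) *
            Real.exp (m * r) := mul_nonneg (by linarith) (Real.exp_pos _).le
        _ = _ := by ring
    have h1 := hmono (left_mem_Icc.2 hs.2.le) (right_mem_Icc.2 hs.2.le) hs.2.le
    simp only [hs0, lowerGamma_zero, zero_mul] at h1
    have h2 := mul_neg_of_neg_of_pos (lowerGamma_neg_of_neg_of_even hn hneg)
      (Real.exp_pos (m * t))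
    linarith
  · obtain ⟨b, hb, hxb⟩ := hx.exists_pos_after ht
    have hsub : Icc t b ⊆ Ico (0 : ℝ) 1 := fun r hr => ⟨ht.1.trans hr.1, hr.2.trans_lt hb.2⟩
    obtain ⟨s, hs, hs0, hxneg⟩ := exists_first_zero hb.1.le (hx.continuousOn.mono hsub) hneg hxb.le
    have hsub' : Icc t s ⊆ Ico (0 : ℝ) 1 := (Icc_subset_Icc_right hs.2).trans hsub
    have hmono : MonotoneOn (fun s => lowerGamma n (x s)) (Icc t s) := by
      refine monotoneOn_of_hasDerivWithinAt_nonneg (convex_Icc t s)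
        (fun r hr => (hx.ode r (hsub' hr)).continuousWithinAt.mono hsub')
        (fun r hr => (hx.ode r (hsub' (interior_subset hr))).mono
          (interior_subset.trans hsub')) fun r hr => ?_
      have hr' := hsub' (interior_subset hr)
      rw [interior_Icc] at hr
      have h1 := lowerGamma_neg_of_neg_of_even hn.add_one (hxneg r ⟨hr.1.le, hr.2⟩)
      have h2 := mul_nonneg hd.le (hp.nonneg r hr')
      linarith
    have h1 := hmono (left_mem_Icc.2 hs.1.le) (right_mem_Icc.2 hs.1.le) hs.1.le
    simp only [hs0, lowerGamma_zero] at h1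
    linarith [lowerGamma_pos_of_neg_of_odd hn hneg]

/-- An interior zero would be a minimum of `lowerGamma n x`, yet the derivative there equals `d * p
> 0`. -/
theorem pos (hx : IsComponent n d p x) (hp : IsInflow ((n + 1)! : ℕ) p) :
    ∀ t ∈ Ioo (0 : ℝ) 1, 0 < x t := by
  intro t ht
  refine lt_of_le_of_ne (hx.nonneg hp t (Ioo_subset_Ico_self ht)) fun h0 => ?_
  have hmin : IsLocalMin (fun s => lowerGamma n (x s)) t := by
    filter_upwards [Ico_mem_nhds ht.1 ht.2] with s hs
    rw [← h0, lowerGamma_zero]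
    exact lowerGamma_nonneg n (hx.nonneg hp s hs)
  have h := hmin.hasDerivAt_eq_zero
    ((hx.ode t (Ioo_subset_Ico_self ht)).hasDerivAt (Ico_mem_nhds ht.1 ht.2))
  rw [← h0, lowerGamma_zero, sub_zero] at h
  exact (mul_pos (hx.coeff_pos hp) (hp.pos t ht)).ne' h

theorem monotoneOn (hx : IsComponent n d p x) (hp : IsInflow ((n + 1)! : ℕ) p) :
    MonotoneOn x (Ico 0 1) := by
  have hnn := hx.nonneg hp
  have h := monotoneOn_of_deriv_eq_sub hx.ode 
    (fun _ hs _ ht h => mul_le_mul_of_nonneg_left (hp.mono hs ht h) (hx.coeff_pos hp).le) ?_ ?_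
  · intro s hs t ht hst
    exact ((strictMonoOn_lowerGamma n).le_iff_le (hnn s hs) (hnn t ht)).1 (h hs ht hst)
  · intro s hs t ht hlt
    exact (strictMonoOn_lowerGamma (n + 1)).monotoneOn (hnn t ht) (hnn s hs)
      (((strictMonoOn_lowerGamma n).lt_iff_lt (hnn t ht) (hnn s hs)).1 hlt).le
  · intro t ht
    rw [hx.init, lowerGamma_zero]
    exact lowerGamma_nonneg n (hnn t ht)

theorem isInflow (hx : IsComponent n d p x) (hp : IsInflow ((n + 1)! : ℕ) p) :
    IsInflow ((n + 1)! : ℕ) (fun t => lowerGamma (n + 1) (x t)) where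
  mono _ hs _ ht hst := (strictMonoOn_lowerGamma (n + 1)).monotoneOn (hx.nonneg hp _ hs)
    (hx.nonneg hp _ ht) (hx.monotoneOn hp hs ht hst)
  nonneg t ht := lowerGamma_nonneg _ (hx.nonneg hp t ht)
  pos t ht := lowerGamma_pos _ (hx.pos hp t ht)
  le t ht := (lowerGamma_lt_factorial _ (hx.nonneg hp t ht)).le

/-- For `d ≤ 1` the inflow is at most `(n + 1)!`, so the gap `n! - lowerGamma n x` closes no faster
than the tail of order `n + 1`, which is too slow to vanish at time `1`. -/
theorem one_lt_coeff (hx : IsComponent n d p x) (hp : IsInflow ((n + 1)! : ℕ) p) : 1 < d := by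
  by_contra! hd
  obtain ⟨A, hA⟩ := exists_factorial_sub_lowerGamma_succ_le n
  refine not_tendsto_zero_of_deriv_ge (w := fun t => (n ! : ℝ) - lowerGamma n (x t)) (A := A)
    one_pos (fun t ht => ?_) (fun t ht => (hx.ode t ht).const_sub _) (fun t ht => ?_) ?_
  · linarith [lowerGamma_lt_factorial n (hx.nonneg hp t ht)]
  · have h1 := hA (x t) (hx.nonneg hp t ht)
    have h2 := mul_le_of_le_one_left (hp.nonneg t ht) hd
    have h3 := hp.le t ht
    linarith
  · have := ((tendsto_lowerGamma_atTop n).comp hx.terminal).const_sub (n ! : ℝ)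
    rwa [sub_self] at this

end IsComponent

/-! ### The outflow as a function of `u`, and its Lipschitz truncations. -/

/-- The inverse of `lowerGamma n` on `[0, ∞)`, extended by `0` to negative arguments. -/
noncomputable def invLowerGamma (n : ℕ) (u : ℝ) : ℝ :=
  Function.invFunOn (lowerGamma n) (Ici 0) (max u 0)

theorem invLowerGamma_spec {n : ℕ} {u : ℝ} (hu : u < (n ! : ℝ)) :
    invLowerGamma n u ∈ Ici (0 : ℝ) ∧ lowerGamma n (invLowerGamma n u) = max u 0 := by
  have hlt : max u 0 < (n ! : ℝ) := max_lt hu (by positivity)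
  have hex : ∃ a ∈ Ici (0 : ℝ), lowerGamma n a = max u 0 := by
    obtain ⟨b, hb, hb0⟩ := (((tendsto_lowerGamma_atTop n).eventually_const_lt hlt).and
      (eventually_ge_atTop 0)).exists
    obtain ⟨a, ha, hau⟩ := intermediate_value_Icc hb0 (continuous_lowerGamma n).continuousOn
      (show max u 0 ∈ Icc (lowerGamma n 0) (lowerGamma n b) from
        ⟨by simp, hb.le⟩)
    exact ⟨a, ha.1, hau⟩
  exact Function.invFunOn_pos hex

theorem invLowerGamma_nonneg {n : ℕ} {u : ℝ} (hu : u < (n ! : ℝ)) : 0 ≤ invLowerGamma n u :=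
  (invLowerGamma_spec hu).1

theorem lowerGamma_invLowerGamma {n : ℕ} {u : ℝ} (hu : u < (n ! : ℝ)) :
    lowerGamma n (invLowerGamma n u) = max u 0 :=
  (invLowerGamma_spec hu).2

theorem invLowerGamma_lt_iff {n : ℕ} {u a : ℝ} (hu : u < (n ! : ℝ)) (ha : 0 ≤ a) :
    invLowerGamma n u < a ↔ max u 0 < lowerGamma n a := by
  rw [← lowerGamma_invLowerGamma hu,
    (strictMonoOn_lowerGamma n).lt_iff_lt (invLowerGamma_nonneg hu) ha]

theorem lt_invLowerGamma_iff {n : ℕ} {u a : ℝ} (hu : u < (n ! : ℝ)) (ha : 0 ≤ a) :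
    a < invLowerGamma n u ↔ lowerGamma n a < max u 0 := by
  rw [← lowerGamma_invLowerGamma hu,
    (strictMonoOn_lowerGamma n).lt_iff_lt ha (invLowerGamma_nonneg hu)]

theorem invLowerGamma_lowerGamma (n : ℕ) {x : ℝ} (hx : 0 ≤ x) :
    invLowerGamma n (lowerGamma n x) = x := by
  have h := lowerGamma_lt_factorial n hx
  refine (strictMonoOn_lowerGamma n).injOn (invLowerGamma_nonneg h) hx ?_
  rw [lowerGamma_invLowerGamma h, max_eq_left (lowerGamma_nonneg n hx)]

theorem invLowerGamma_of_nonpos (n : ℕ) {u : ℝ} (hu : u ≤ 0) : invLowerGamma n u = 0 := by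
  have h := invLowerGamma_lowerGamma n le_rfl
  rw [lowerGamma_zero] at h
  rw [← h, invLowerGamma, invLowerGamma, max_eq_right hu, max_self]

theorem invLowerGamma_mono {n : ℕ} {u v : ℝ} (huv : u ≤ v) (hv : v < (n ! : ℝ)) :
    invLowerGamma n u ≤ invLowerGamma n v := by
  have hu := huv.trans_lt hv
  rw [← (strictMonoOn_lowerGamma n).le_iff_le (invLowerGamma_nonneg hu) (invLowerGamma_nonneg hv),
    lowerGamma_invLowerGamma hu, lowerGamma_invLowerGamma hv]
  exact max_le_max_right 0 huv

theorem continuousAt_invLowerGamma {n : ℕ} {u : ℝ} (hu : u < (n ! : ℝ)) :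
    ContinuousAt (invLowerGamma n) u := by
  have hmax : ContinuousAt (fun v : ℝ => max v 0) u := by fun_prop
  refine tendsto_order.2 ⟨fun a ha => ?_, fun a ha => ?_⟩
  · rcases lt_or_ge a 0 with h0 | h0
    · filter_upwards [eventually_lt_nhds hu] with v hv
      exact h0.trans_le (invLowerGamma_nonneg hv)
    · filter_upwards [eventually_lt_nhds hu,
        hmax.eventually (eventually_gt_nhds ((lt_invLowerGamma_iff hu h0).1 ha))] with v hv h
      exact (lt_invLowerGamma_iff hv h0).2 h
  · have h0 : 0 ≤ a := (invLowerGamma_nonneg hu).trans ha.le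
    filter_upwards [eventually_lt_nhds hu,
      hmax.eventually (eventually_lt_nhds ((invLowerGamma_lt_iff hu h0).1 ha))] with v hv h
    exact (invLowerGamma_lt_iff hv h0).2 h

open Classical in
/-- `lowerGamma (n + 1)` as a function of the value of `lowerGamma n`, extended by constants. -/
noncomputable def outflow (n : ℕ) (u : ℝ) : ℝ :=
  if u < (n ! : ℝ) then lowerGamma (n + 1) (invLowerGamma n u) else ((n + 1)! : ℕ)

theorem outflow_of_lt {n : ℕ} {u : ℝ} (hu : u < (n ! : ℝ)) :
    outflow n u = lowerGamma (n + 1) (invLowerGamma n u) := if_pos hu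

theorem outflow_of_ge {n : ℕ} {u : ℝ} (hu : (n ! : ℝ) ≤ u) : outflow n u = ((n + 1)! : ℕ) :=
  if_neg (not_lt.2 hu)

theorem outflow_le (n : ℕ) (u : ℝ) : outflow n u ≤ ((n + 1)! : ℕ) := by
  rcases lt_or_ge u (n ! : ℝ) with h | h
  · rw [outflow_of_lt h]
    exact (lowerGamma_lt_factorial _ (invLowerGamma_nonneg h)).le
  · rw [outflow_of_ge h]

theorem outflow_nonneg (n : ℕ) (u : ℝ) : 0 ≤ outflow n u := by
  rcases lt_or_ge u (n ! : ℝ) with h | h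
  · rw [outflow_of_lt h]
    exact lowerGamma_nonneg _ (invLowerGamma_nonneg h)
  · rw [outflow_of_ge h]
    positivity

theorem outflow_of_nonpos (n : ℕ) {u : ℝ} (hu : u ≤ 0) : outflow n u = 0 := by
  rw [outflow_of_lt (hu.trans_lt (by positivity)), invLowerGamma_of_nonpos n hu, lowerGamma_zero]

theorem outflow_lowerGamma (n : ℕ) {x : ℝ} (hx : 0 ≤ x) :
    outflow n (lowerGamma n x) = lowerGamma (n + 1) x := by
  rw [outflow_of_lt (lowerGamma_lt_factorial n hx), invLowerGamma_lowerGamma n hx]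

theorem monotone_outflow (n : ℕ) : Monotone (outflow n) := by
  intro u v huv
  rcases lt_or_ge v (n ! : ℝ) with h | h
  · rw [outflow_of_lt h, outflow_of_lt (huv.trans_lt h)]
    exact (strictMonoOn_lowerGamma _).monotoneOn (invLowerGamma_nonneg (huv.trans_lt h))
      (invLowerGamma_nonneg h) (invLowerGamma_mono huv h)
  · rw [outflow_of_ge h]
    exact outflow_le n u

theorem outflow_sub_le (n : ℕ) {N u v : ℝ} (hN : 0 ≤ N) (huv : u ≤ v) (hv : v ≤ lowerGamma n N) :
    outflow n v - outflow n u ≤ N * (v - u) := by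
  have hv' : v < (n ! : ℝ) := hv.trans_lt (lowerGamma_lt_factorial n hN)
  have hu' := huv.trans_lt hv'
  rw [outflow_of_lt hv', outflow_of_lt hu']
  have hle : invLowerGamma n v ≤ N := by
    rw [← (strictMonoOn_lowerGamma n).le_iff_le (invLowerGamma_nonneg hv') hN,
      lowerGamma_invLowerGamma hv']
    exact max_le hv (lowerGamma_nonneg n hN)
  refine (lowerGamma_succ_sub_le n (invLowerGamma_nonneg hu') (invLowerGamma_mono huv hv')
    hle).trans (mul_le_mul_of_nonneg_left ?_ hN)
  rw [lowerGamma_invLowerGamma hv', lowerGamma_invLowerGamma hu']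
  rcases le_total v 0 with h | h
  · rw [max_eq_right h, max_eq_right (huv.trans h)]
    linarith
  · rw [max_eq_left h]
    linarith [le_max_left u 0]

/-- The Lipschitz truncation of `outflow`, constant above the level `lowerGamma n N`. -/
noncomputable def truncOutflow (n N : ℕ) (u : ℝ) : ℝ := outflow n (min u (lowerGamma n N))

theorem lipschitzWith_truncOutflow (n N : ℕ) : LipschitzWith N (truncOutflow n N) := by
  refine LipschitzWith.of_le_add_mul _ fun u v => ?_
  have hN : (0 : ℝ) ≤ N := by positivity
  rcases le_total u v with h | h
  · have h1 : truncOutflow n N u ≤ truncOutflow n N v := monotone_outflow n (min_le_min_right _ h)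
    have h2 : 0 ≤ (((N : NNReal) : ℝ)) * dist u v := by positivity
    linarith
  · have h1 := outflow_sub_le n hN (min_le_min_right (lowerGamma n N) h) (min_le_right _ _)
    have h2 : min u (lowerGamma n N) - min v (lowerGamma n N) ≤ u - v := by
      rcases le_total v (lowerGamma n N) with h3 | h3
      · rw [min_eq_left h3]
        linarith [min_le_left u (lowerGamma n N)]
      · rw [min_eq_right h3, min_eq_right (h3.trans h)]
        linarith
    have h3 := mul_le_mul_of_nonneg_left h2 hN
    rw [Real.dist_eq, abs_of_nonneg (sub_nonneg.2 h)]
    simp only [NNReal.coe_natCast, truncOutflow]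
    linarith

theorem abs_outflow_sub_truncOutflow_le (n N : ℕ) (u : ℝ) :
    |outflow n u - truncOutflow n N u| ≤ ((n + 1)! : ℕ) - lowerGamma (n + 1) N := by
  have hN : (0 : ℝ) ≤ N := by positivity
  have h1 : truncOutflow n N u ≤ outflow n u := monotone_outflow n (min_le_left _ _)
  rw [abs_of_nonneg (sub_nonneg.2 h1), truncOutflow]
  rcases le_total u (lowerGamma n N) with h | h
  · rw [min_eq_left h, sub_self, sub_nonneg]
    exact (lowerGamma_lt_factorial _ hN).le
  · rw [min_eq_right h, outflow_lowerGamma n hN]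
    linarith [outflow_le n u]

theorem tendsto_factorial_sub_lowerGamma (n : ℕ) :
    Tendsto (fun N : ℕ => ((n ! : ℕ) : ℝ) - lowerGamma n N) atTop (𝓝 0) := by
  have := ((tendsto_lowerGamma_atTop n).comp tendsto_natCast_atTop_atTop).const_sub (n ! : ℝ)
  rwa [sub_self] at this

/-! ### The Cauchy problem on `[0, 1]` for a given inflow. -/

/-- Solutions of `u' = f - h u` with monotone `h` depend on `f` and `h` in a Lipschitz way. -/
theorem abs_sub_le_of_monotone {u v f g h m : ℝ → ℝ} {δ ε : ℝ} (hδ : 0 ≤ δ) (hε : 0 ≤ ε)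
    (hu : ∀ t ∈ Icc (0 : ℝ) 1, HasDerivWithinAt u (f t - h (u t)) (Icc 0 1) t)
    (hv : ∀ t ∈ Icc (0 : ℝ) 1, HasDerivWithinAt v (g t - m (v t)) (Icc 0 1) t)
    (hh : Monotone h) (hfg : ∀ t ∈ Ico (0 : ℝ) 1, |f t - g t| ≤ δ)
    (hhm : ∀ y, |h y - m y| ≤ ε) (h0 : u 0 = v 0) :
    ∀ t ∈ Icc (0 : ℝ) 1, |u t - v t| ≤ δ + ε := by
  intro t ht
  have hcu : ContinuousOn u (Icc 0 1) := fun r hr => (hu r hr).continuousWithinAt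
  have hcv : ContinuousOn v (Icc 0 1) := fun r hr => (hv r hr).continuousWithinAt
  have hdu : ∀ r ∈ Ico (0 : ℝ) 1, HasDerivWithinAt u (f r - h (u r)) (Ici r) r := fun r hr =>
    ((hu r (Ico_subset_Icc_self hr)).mono Ico_subset_Icc_self).Ici_of_Ico hr
  have hdv : ∀ r ∈ Ico (0 : ℝ) 1, HasDerivWithinAt v (g r - m (v r)) (Ici r) r := fun r hr =>
    ((hv r (Ico_subset_Icc_self hr)).mono Ico_subset_Icc_self).Ici_of_Ico hr
  have hle : (δ + ε) * (t - 0) ≤ δ + ε :=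
    mul_le_of_le_one_right (by positivity) (by linarith [ht.2])
  have h1 := le_add_mul_of_deriv_right_le_of_pos (C := δ + ε) le_rfl (by positivity)
    (hcu.sub hcv) (fun r hr => (hdu r hr).sub (hdv r hr)) (by simp [h0]) (fun r hr hpos => by
      have h1 := hh (sub_pos.1 hpos).le
      have h2 := abs_le.1 (hfg r hr)
      have h3 := abs_le.1 (hhm (v r))
      linarith [h2.1, h2.2, h3.1, h3.2]) t ht
  have h2 := le_add_mul_of_deriv_right_le_of_pos (C := δ + ε) le_rfl (by positivity)
    (hcv.sub hcu) (fun r hr => (hdv r hr).sub (hdu r hr)) (by simp [h0]) (fun r hr hpos => by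
      have h1 := hh (sub_pos.1 hpos).le
      have h2 := abs_le.1 (hfg r hr)
      have h3 := abs_le.1 (hhm (v r))
      linarith [h2.1, h2.2, h3.1, h3.2]) t ht
  simp only [Pi.sub_apply] at h1 h2
  exact abs_le.2 ⟨by linarith, by linarith⟩

/-- Since `h` is bounded, the speed is at most `F + M`; a ball of that radius suffices for the whole
unit time interval. -/
theorem exists_solution_of_lipschitzWith {f h : ℝ → ℝ} {M : ℝ} {K : NNReal} (hf : Continuous f)
    (hh : LipschitzWith K h) (hM : ∀ y, |h y| ≤ M) :
    ∃ u : ℝ → ℝ, u 0 = 0 ∧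
      ∀ t ∈ Icc (0 : ℝ) 1, HasDerivWithinAt u (f t - h (u t)) (Icc 0 1) t := by
  obtain ⟨F, hF⟩ := (isCompact_Icc (a := (0 : ℝ)) (b := 1)).exists_bound_of_continuousOn
    hf.continuousOn
  have hF0 : 0 ≤ F := (norm_nonneg _).trans (hF 0 (left_mem_Icc.2 zero_le_one))
  have hM0 : 0 ≤ M := (abs_nonneg _).trans (hM 0)
  have hPL : IsPicardLindelof (fun t y => f t - h y)
      (⟨0, left_mem_Icc.2 zero_le_one⟩ : Icc (0 : ℝ) 1) (0 : ℝ)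
      (Real.toNNReal (F + M)) 0 (Real.toNNReal (F + M)) K :=
    { lipschitzOnWith := fun t _ => by
        have : LipschitzWith (0 + K) fun y => f t - h y := (LipschitzWith.const (f t)).sub hh
        rw [zero_add] at this
        exact this.lipschitzOnWith
      continuousOn := fun y _ => by fun_prop
      norm_le := fun t ht y _ => by
        rw [Real.coe_toNNReal _ (by positivity)]
        exact (norm_sub_le _ _).trans (add_le_add (hF t ht) (hM y))
      mul_max_le := by simp }
  exact hPL.exists_eq_forall_mem_Icc_hasDerivWithinAt₀

theorem continuous_outflow (n : ℕ) : Continuous (outflow n) := by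
  have hunif : TendstoUniformly (truncOutflow n) (outflow n) atTop := by
    refine Metric.tendstoUniformly_iff.2 fun ε hε => ?_
    filter_upwards [(tendsto_factorial_sub_lowerGamma (n + 1)).eventually_lt_const hε] with N hN u
    exact (abs_outflow_sub_truncOutflow_le n N u).trans_lt hN
  exact hunif.continuous (Eventually.frequently (Eventually.of_forall fun N =>
    (lipschitzWith_truncOutflow n N).continuous))

/-- Picard–Lindelöf is applied to the truncations. Their Lipschitz constants blow up, but
monotonicity makes the distance between two solutions controlled by the truncation errors alone, so
the solutions converge uniformly. -/
theorem exists_outflow_solution (n : ℕ) {f : ℝ → ℝ} (hf : Continuous f) :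
    ∃ u : ℝ → ℝ, Continuous u ∧ u 0 = 0 ∧
      ∀ t ∈ Icc (0 : ℝ) 1, HasDerivWithinAt u (f t - outflow n (u t)) (Icc 0 1) t := by
  set e : ℕ → ℝ := fun N => (((n + 1)! : ℕ) : ℝ) - lowerGamma (n + 1) N with he
  have he0 : ∀ N, 0 ≤ e N := fun N =>
    sub_nonneg.2 (lowerGamma_lt_factorial _ (Nat.cast_nonneg N)).le
  have hmono : ∀ N, Monotone (truncOutflow n N) := fun N u v huv =>
    monotone_outflow n (min_le_min_right _ huv)
  have habs : ∀ u, |outflow n u| ≤ ((n + 1)! : ℕ) := fun u => by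
    rw [abs_of_nonneg (outflow_nonneg n u)]
    exact outflow_le n u
  choose u hu0 hu using fun N => exists_solution_of_lipschitzWith hf
    (lipschitzWith_truncOutflow n N) (fun y => habs _)
  have hdist : ∀ N N', ∀ t ∈ Icc (0 : ℝ) 1, |u N t - u N' t| ≤ e N + e N' := by
    intro N N' t ht
    have := abs_sub_le_of_monotone (δ := 0) le_rfl (add_nonneg (he0 N) (he0 N')) (hu N) (hu N')
      (hmono N) (fun t _ => by simp) (fun y => ?_) (by rw [hu0, hu0]) t ht
    · rwa [zero_add] at this
    · have h1 := abs_outflow_sub_truncOutflow_le n N y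
      have h2 := abs_outflow_sub_truncOutflow_le n N' y
      rw [abs_le] at h1 h2 ⊢
      constructor <;> linarith [h1.1, h1.2, h2.1, h2.2]
  have hcauchy : ∀ t ∈ Icc (0 : ℝ) 1, ∃ l, Tendsto (fun N => u N t) atTop (𝓝 l) := by
    intro t ht
    refine cauchySeq_tendsto_of_complete (Metric.cauchySeq_iff.2 fun ε hε => ?_)
    obtain ⟨N0, hN0⟩ := eventually_atTop.1
      ((tendsto_factorial_sub_lowerGamma (n + 1)).eventually_lt_const (half_pos hε))
    refine ⟨N0, fun N hN N' hN' => ?_⟩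
    rw [Real.dist_eq]
    linarith [hdist N N' t ht, hN0 N hN, hN0 N' hN']
  choose! l hl using hcauchy
  have hunif : TendstoUniformlyOn u l atTop (Icc 0 1) := by
    refine Metric.tendstoUniformlyOn_iff.2 fun ε hε => ?_
    filter_upwards [(tendsto_factorial_sub_lowerGamma (n + 1)).eventually_lt_const hε]
      with N hN t ht
    refine lt_of_le_of_lt ?_ hN
    have h1 : Tendsto (fun N' => |u N' t - u N t|) atTop (𝓝 |l t - u N t|) :=
      ((hl t ht).sub_const _).abs
    have h2 : Tendsto (fun N' => e N' + e N) atTop (𝓝 (0 + e N)) :=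
      (tendsto_factorial_sub_lowerGamma (n + 1)).add_const _
    rw [zero_add] at h2
    exact le_of_tendsto_of_tendsto' h1 h2 fun N' => hdist N' N t ht
  have hcu : ∀ N, ContinuousOn (u N) (Icc 0 1) := fun N t ht => (hu N t ht).continuousWithinAt
  have hcl : ContinuousOn l (Icc 0 1) :=
    hunif.continuousOn (Eventually.frequently (Eventually.of_forall hcu))
  set L : ℝ → ℝ := IccExtend (zero_le_one' ℝ) ((Icc 0 1).domRestrict l) with hL
  have hLc : Continuous L := (continuousOn_iff_continuous_domRestrict.1 hcl).Icc_extend'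
  have hLl : ∀ t ∈ Icc (0 : ℝ) 1, L t = l t := fun t ht => by
    rw [hL, IccExtend_of_mem _ _ ht, domRestrict_apply]
  have hint : Continuous fun t => f t - outflow n (L t) :=
    hf.sub ((continuous_outflow n).comp hLc)
  -- The limit `l` is shown to satisfy the integral equation; writing it as an integral with the
  -- extension `L` yields a function continuous on all of `ℝ`.
  set v : ℝ → ℝ := fun t => ∫ s in (0 : ℝ)..t, (f s - outflow n (L s)) with hv
  have hvd : ∀ t, HasDerivAt v (f t - outflow n (L t)) t := fun t =>
    intervalIntegral.integral_hasDerivAt_right (hint.intervalIntegrable _ _)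
      (hint.stronglyMeasurableAtFilter _ _) hint.continuousAt
  have hvl : ∀ t ∈ Icc (0 : ℝ) 1, v t = l t := by
    intro t ht
    have hsub : Icc 0 t ⊆ Icc (0 : ℝ) 1 := Icc_subset_Icc_right ht.2
    have hcint : ∀ N, ContinuousOn (fun s => f s - truncOutflow n N (u N s)) (Icc 0 t) :=
      fun N => hf.continuousOn.sub
        ((lipschitzWith_truncOutflow n N).continuous.comp_continuousOn ((hcu N).mono hsub))
    have heq : ∀ N, ∫ s in (0 : ℝ)..t, (f s - truncOutflow n N (u N s)) = u N t := by
      intro N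
      rw [intervalIntegral.integral_eq_sub_of_hasDeriv_right_of_le ht.1 ((hcu N).mono hsub)
        (fun s hs => ?_) ((hcint N).intervalIntegrable_of_Icc ht.1), hu0, sub_zero]
      have hs' : s ∈ Ico (0 : ℝ) 1 := ⟨hs.1.le, hs.2.trans_le ht.2⟩
      exact (((hu N s (Ico_subset_Icc_self hs')).mono Ico_subset_Icc_self).Ici_of_Ico hs').mono
        Ioi_subset_Ici_self
    obtain ⟨F, hF⟩ := (isCompact_Icc (a := (0 : ℝ)) (b := t)).exists_bound_of_continuousOn
      hf.continuousOn
    have hlim : Tendsto (fun N => ∫ s in (0 : ℝ)..t, (f s - truncOutflow n N (u N s))) atTop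
        (𝓝 (v t)) := by
      refine intervalIntegral.tendsto_integral_filter_of_dominated_convergence
        (fun _ => F + ((n + 1)! : ℕ)) (Eventually.of_forall fun N => ?_)
        (Eventually.of_forall fun N => MeasureTheory.ae_of_all _ fun s hs => ?_)
        intervalIntegrable_const (MeasureTheory.ae_of_all _ fun s hs => ?_)
      · rw [uIoc_of_le ht.1]
        exact ((hcint N).mono Ioc_subset_Icc_self).aestronglyMeasurable measurableSet_Ioc
      · rw [uIoc_of_le ht.1] at hs
        exact (norm_sub_le _ _).trans (add_le_add (hF s (Ioc_subset_Icc_self hs)) (habs _))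
      · rw [uIoc_of_le ht.1] at hs
        have hs' := hsub (Ioc_subset_Icc_self hs)
        rw [hLl s hs']
        refine Tendsto.const_sub _ ?_
        have h1 : Tendsto (fun N => outflow n (u N s)) atTop (𝓝 (outflow n (l s))) :=
          ((continuous_outflow n).tendsto _).comp (hl s hs')
        have h2 : Tendsto (fun N => outflow n (u N s) - truncOutflow n N (u N s)) atTop (𝓝 0) :=
          squeeze_zero_norm (fun N => abs_outflow_sub_truncOutflow_le n N (u N s))
            (tendsto_factorial_sub_lowerGamma (n + 1))
        simpa using h1.sub h2
    simp only [heq] at hlim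
    exact tendsto_nhds_unique hlim (hl t ht)
  refine ⟨v, continuous_iff_continuousAt.2 fun t => (hvd t).continuousAt, by simp [hv],
    fun t ht => ?_⟩
  rw [hvl t ht, ← hLl t ht]
  exact (hvd t).hasDerivWithinAt

/-! ### Shooting: reaching `n!` at time `1` and not before. -/

/-- A solution with inflow `c * p` that ends at the saturation level `n!` stays below it before. -/
theorem lt_factorial_of_outflow_solution {n : ℕ} {p u : ℝ → ℝ} {c : ℝ} (hc : 0 ≤ c)
    (hp : IsInflow ((n + 1)! : ℕ) p) (hcu : Continuous u) (hu0 : u 0 = 0) (hu1 : u 1 = (n ! : ℝ))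
    (hu : ∀ t ∈ Icc (0 : ℝ) 1, HasDerivWithinAt u (c * p t - outflow n (u t)) (Icc 0 1) t)
    (hnn : ∀ t ∈ Icc (0 : ℝ) 1, 0 ≤ u t) : ∀ t ∈ Ico (0 : ℝ) 1, u t < (n ! : ℝ) := by
  intro τ hτ
  by_contra! hge
  have hcp : MonotoneOn (fun t => c * p t) (Ico 0 1) := fun _ hs _ ht h =>
    mul_le_mul_of_nonneg_left (hp.mono hs ht h) hc
  have hmono : MonotoneOn u (Ico 0 1) := monotoneOn_of_deriv_eq_sub
    (fun t ht => (hu t (Ico_subset_Icc_self ht)).mono Ico_subset_Icc_self) hcp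
    (fun s _ t _ hlt => monotone_outflow n hlt.le)
    (fun t ht => by rw [hu0]; exact hnn t (Ico_subset_Icc_self ht))
  have hfac : (0 : ℝ) < (n ! : ℝ) := by positivity
  obtain ⟨s, hs, hs0, hlt⟩ := exists_first_zero (x := fun t => u t - (n ! : ℝ)) hτ.1
    (by fun_prop) (by simpa [hu0] using hfac) (by simpa using hge)
  simp only [sub_neg, sub_eq_zero] at hs0 hlt
  have hs1 : s < 1 := hs.2.trans_lt hτ.2
  have heq : ∀ r ∈ Ico s 1, u r = (n ! : ℝ) := by
    intro r hr
    have hr' : r ∈ Ico (0 : ℝ) 1 := ⟨hs.1.le.trans hr.1, hr.2⟩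
    refine le_antisymm ?_ (hs0 ▸ hmono ⟨hs.1.le, hs1⟩ hr' hr.1)
    rw [← hu1]
    refine ge_of_tendsto ((hcu.tendsto 1).mono_left (nhdsWithin_le_nhds (s := Iio 1))) ?_
    filter_upwards [Ico_mem_nhdsLT hr.2] with y hy
    exact hmono hr' ⟨hr'.1.trans hy.1, hy.2⟩ hy.1
  obtain ⟨r, hsr, hr1⟩ := exists_between hs1
  have hr : r ∈ Ioo (0 : ℝ) 1 := ⟨hs.1.trans hsr, hr1⟩
  -- On the plateau `u = n!` the derivative vanishes, which forces `c * p r = (n + 1)!`. By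
  -- monotonicity `c * p ≤ (n + 1)!` before `s`, so the Osgood bound prevents `u` from reaching `n!`
  -- at `s`.
  have hder : HasDerivAt u 0 r := by
    refine (hasDerivAt_const r (n ! : ℝ)).congr_of_eventuallyEq ?_
    filter_upwards [Ioo_mem_nhds hsr hr1] with y hy using heq y (Ioo_subset_Ico_self hy)
  have hval := hder.unique ((hu r (Ioo_subset_Icc_self hr)).hasDerivAt (Icc_mem_nhds hr.1 hr.2))
  rw [heq r ⟨hsr.le, hr1⟩, outflow_of_ge le_rfl] at hval
  obtain ⟨A, hA⟩ := exists_factorial_sub_lowerGamma_succ_le n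
  have hsub : Ico 0 s ⊆ Ico (0 : ℝ) 1 := Ico_subset_Ico_right hs1.le
  refine not_tendsto_zero_of_deriv_ge (w := fun t => (n ! : ℝ) - u t) (A := A) hs.1
    (fun t ht => sub_pos.2 (hlt t ht)) (fun t ht => ((hu t (Ico_subset_Icc_self (hsub ht))).mono
      (hsub.trans Ico_subset_Icc_self)).const_sub _) (fun t ht => ?_) ?_
  · have h1 := hA _ (invLowerGamma_nonneg (hlt t ht))
    rw [lowerGamma_invLowerGamma (hlt t ht),
      max_eq_left (hnn t (Ico_subset_Icc_self (hsub ht))), ← outflow_of_lt (hlt t ht)] at h1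
    have h2 := hcp (hsub ht) (Ioo_subset_Ico_self hr) (ht.2.le.trans hsr.le)
    simp only at h2
    linarith
  · have h1 : Tendsto (fun t => (n ! : ℝ) - u t) (𝓝 s) (𝓝 ((n ! : ℝ) - u s)) :=
      (continuous_const.sub hcu).tendsto s
    rw [hs0, sub_self] at h1
    exact h1.mono_left nhdsWithin_le_nhds

/-- For a suitable factor `c`, the solution with inflow `c * p` reaches the level `n!` exactly at
time `1`. -/
theorem exists_coeff_outflow_solution {n : ℕ} {p : ℝ → ℝ} (hp : IsInflow ((n + 1)! : ℕ) p)
    (hpc : Continuous p) :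
    ∃ c : ℝ, 0 ≤ c ∧ ∃ u : ℝ → ℝ, Continuous u ∧ u 0 = 0 ∧ u 1 = (n ! : ℝ) ∧
      ∀ t ∈ Icc (0 : ℝ) 1, HasDerivWithinAt u (c * p t - outflow n (u t)) (Icc 0 1) t := by
  choose u hcu hu0 hu using fun c : ℝ => exists_outflow_solution n (hpc.const_mul c)
  have hmem1 : (1 : ℝ) ∈ Icc (0 : ℝ) 1 := right_mem_Icc.2 zero_le_one
  set M : ℝ := (((n + 1)! : ℕ) : ℝ) with hM
  have hM0 : 0 ≤ M := by positivity
  have hcont : Continuous fun c => u c 1 := by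
    refine (LipschitzWith.of_dist_le' (K := M) fun c c' => ?_).continuous
    rw [Real.dist_eq, Real.dist_eq]
    have h := abs_sub_le_of_monotone (δ := M * |c - c'|) (ε := 0) (by positivity) le_rfl
      (hu c) (hu c') (monotone_outflow n) (fun t ht => ?_) (fun y => by simp)
      (by rw [hu0, hu0]) 1 hmem1
    · rwa [add_zero] at h
    · rw [← sub_mul, abs_mul, abs_of_nonneg (hp.nonneg t ht), mul_comm]
      exact mul_le_mul_of_nonneg_right (hp.le t ht) (abs_nonneg _)
  have hright : ∀ c, ∀ t ∈ Ico (0 : ℝ) 1,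
      HasDerivWithinAt (u c) (c * p t - outflow n (u c t)) (Ici t) t := fun c t ht =>
    ((hu c t (Ico_subset_Icc_self ht)).mono Ico_subset_Icc_self).Ici_of_Ico ht
  have hzero : u 0 1 ≤ 0 := by
    have := le_add_mul_of_deriv_right_le_of_pos (A := 0) (C := 0) le_rfl le_rfl
      (hcu 0).continuousOn (hright 0) (hu0 0).le
      (fun t _ _ => by linarith [outflow_nonneg n (u 0 t)]) 1 hmem1
    linarith
  have hhalf : (1 / 2 : ℝ) ∈ Ioo (0 : ℝ) 1 := by norm_num
  have hq := hp.pos _ hhalf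
  set q : ℝ := p (1 / 2) with hq'
  -- On `[0, 1/2]` the solution loses at most `M / 2`; on `[1/2, 1]` its slope is at least `D * q -
  -- M = 2 * n! + M`. Together these give `u 1 ≥ n!`.
  set D : ℝ := 2 * ((n ! : ℝ) + M) / q with hD
  have hD0 : 0 ≤ D := by positivity
  have hlarge : (n ! : ℝ) ≤ u D 1 := by
    have h1 := le_add_mul_of_deriv_right_le_of_pos (w := fun t => -u D t) (A := 0) (C := M)
      le_rfl hM0 (hcu D).neg.continuousOn (fun t ht => (hright D t ht).neg) (by simp [hu0])
      (fun t ht _ => by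
        have h1 := outflow_le n (u D t)
        have h2 := mul_nonneg hD0 (hp.nonneg t ht)
        linarith) (1 / 2) (Ioo_subset_Icc_self hhalf)
    have hsub : Icc (1 / 2 : ℝ) 1 ⊆ Icc 0 1 := Icc_subset_Icc_left (by norm_num)
    have hmono : MonotoneOn (fun t => u D t - (D * q - M) * t) (Icc (1 / 2) 1) := by
      refine monotoneOn_of_hasDerivWithinAt_nonneg (convex_Icc _ _)
        (((hcu D).sub (continuous_const.mul continuous_id)).continuousOn)
        (fun t ht => (((hu D t (hsub (interior_subset ht))).mono hsub).sub
          ((hasDerivWithinAt_id t _).const_mul (D * q - M))).mono interior_subset)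
        fun t ht => ?_
      rw [interior_Icc] at ht
      have h1 := outflow_le n (u D t)
      have h2 := mul_le_mul_of_nonneg_left (hp.mono (Ioo_subset_Ico_self hhalf)
        ⟨by linarith [ht.1], ht.2⟩ ht.1.le) hD0
      linarith
    have h2 := hmono (left_mem_Icc.2 (by norm_num)) (right_mem_Icc.2 (by norm_num)) (by norm_num)
    have h3 : D * q = 2 * ((n ! : ℝ) + M) := div_mul_cancel₀ _ hq.ne'
    simp only [h3] at h2
    linarith
  obtain ⟨c, hc, hc1⟩ := intermediate_value_Icc hD0 hcont.continuousOn
    (show (n ! : ℝ) ∈ Icc (u 0 1) (u D 1) from ⟨hzero.trans (by positivity), hlarge⟩)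
  exact ⟨c, hc.1, u c, hcu c, hu0 c, hc1, hu c⟩

theorem exists_isComponent {n : ℕ} {p : ℝ → ℝ} (hp : IsInflow ((n + 1)! : ℕ) p)
    (hpc : Continuous p) :
    ∃ (d : ℝ) (x q : ℝ → ℝ), IsComponent n d p x ∧ DifferentiableOn ℝ x (Ioo 0 1) ∧
      Continuous q ∧ ∀ t ∈ Ico (0 : ℝ) 1, q t = lowerGamma (n + 1) (x t) := by
  obtain ⟨c, hc, u, hcu, hu0, hu1, hu⟩ := exists_coeff_outflow_solution hp hpc
  have hnn1 : ∀ t ∈ Icc (0 : ℝ) 1, 0 ≤ u t := by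
    intro t ht
    have := le_add_mul_of_deriv_right_le_of_pos (w := fun t => -u t) (A := 0) (C := 0)
      le_rfl le_rfl hcu.neg.continuousOn
      (fun t ht => (((hu t (Ico_subset_Icc_self ht)).mono Ico_subset_Icc_self).Ici_of_Ico ht).neg)
      (by simp [hu0])
      (fun t ht hneg => by
        have h1 := mul_nonneg hc (hp.nonneg t ht)
        rw [outflow_of_nonpos n (by linarith : u t ≤ 0)]
        linarith) t ht
    linarith
  have hnn : ∀ t ∈ Ico (0 : ℝ) 1, 0 ≤ u t := fun t ht => hnn1 t (Ico_subset_Icc_self ht)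
  have hlt := lt_factorial_of_outflow_solution hc hp hcu hu0 hu1 hu hnn1
  have hux : ∀ t ∈ Ico (0 : ℝ) 1, lowerGamma n (invLowerGamma n (u t)) = u t := fun t ht => by
    rw [lowerGamma_invLowerGamma (hlt t ht), max_eq_left (hnn t ht)]
  have hcx : ∀ t ∈ Ico (0 : ℝ) 1, ContinuousAt (fun t => invLowerGamma n (u t)) t :=
    fun t ht => (continuousAt_invLowerGamma (hlt t ht)).comp hcu.continuousAt
  have hx : IsComponent n c p (fun t => invLowerGamma n (u t)) :=
    { continuousOn := fun t ht => (hcx t ht).continuousWithinAt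
      init := by
        simp only [hu0]
        exact invLowerGamma_of_nonpos n le_rfl
      terminal := by
        refine tendsto_atTop.2 fun b => ?_
        have h1 : lowerGamma n (max b 0) < u 1 := by
          rw [hu1]
          exact lowerGamma_lt_factorial n (le_max_right b 0)
        filter_upwards [Ico_mem_nhdsLT (zero_lt_one' ℝ), nhdsWithin_le_nhds
          (hcu.continuousAt.eventually (eventually_gt_nhds h1))] with t ht h
        exact (le_max_left b 0).trans ((lt_invLowerGamma_iff (hlt t ht) (le_max_right b 0)).2
          (lt_max_of_lt_left h)).le
      ode := fun t ht => by
        rw [← outflow_of_lt (hlt t ht)]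
        exact ((hu t (Ico_subset_Icc_self ht)).mono Ico_subset_Icc_self).congr hux (hux t ht) }
  refine ⟨c, fun t => invLowerGamma n (u t), fun t => outflow n (u t), hx, fun t ht => ?_,
    (continuous_outflow n).comp hcu, fun t ht => outflow_of_lt (hlt t ht)⟩
  have ht' := Ioo_subset_Ico_self ht
  have hpos : 0 < invLowerGamma n (u t) := hx.pos hp t ht
  have hupos : 0 < u t := by
    rw [← hux t ht']
    exact lowerGamma_pos n hpos
  -- Positivity of `x` is needed: for `n ≥ 1` the derivative of `lowerGamma n` vanishes at `0`.
  have hinv := HasDerivAt.of_local_left_inverse (continuousAt_invLowerGamma (hlt t ht'))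
    (hasDerivAt_lowerGamma n _) (by positivity) (by
      filter_upwards [Ioo_mem_nhds hupos (hlt t ht')] with v hv
      rw [lowerGamma_invLowerGamma hv.2, max_eq_left hv.1.le])
  exact (hinv.comp t ((hu t (Ioo_subset_Icc_self ht)).hasDerivAt
    (Icc_mem_nhds ht.1 ht.2))).differentiableAt.differentiableWithinAt

/-! ### Assembling a solution from a chain of components. -/

theorem isInflow_const {M : ℝ} (hM : 0 < M) : IsInflow M fun _ => M where
  mono := monotoneOn_const
  nonneg _ _ := hM.le
  pos _ _ := hM
  le _ _ := le_rfl

theorem IsInflow.congr {M : ℝ} {p q : ℝ → ℝ} (hp : IsInflow M p)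
    (h : ∀ t ∈ Ico (0 : ℝ) 1, q t = p t) : IsInflow M q where
  mono s hs t ht hst := by
    rw [h s hs, h t ht]
    exact hp.mono hs ht hst
  nonneg t ht := by
    rw [h t ht]
    exact hp.nonneg t ht
  pos t ht := by
    rw [h t (Ioo_subset_Ico_self ht)]
    exact hp.pos t ht
  le t ht := by
    rw [h t ht]
    exact hp.le t ht

theorem exists_chain (n : ℕ) :
    ∃ (d : ℕ → ℝ) (p x : ℕ → ℝ → ℝ), (∀ i, IsInflow ((n + 1)! : ℕ) (p i)) ∧
      (∀ i, IsComponent n (d i) (p i) (x i)) ∧ (∀ i, DifferentiableOn ℝ (x i) (Ioo 0 1)) ∧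
      (∀ t, p 0 t = ((n + 1)! : ℕ)) ∧
      ∀ i, ∀ t ∈ Ico (0 : ℝ) 1, p (i + 1) t = lowerGamma (n + 1) (x i t) := by
  choose d x q hx hdiff hqc hq using
    fun P : {p : ℝ → ℝ // IsInflow ((n + 1)! : ℕ) p ∧ Continuous p} =>
      exists_isComponent P.2.1 P.2.2
  let P : ℕ → {p : ℝ → ℝ // IsInflow ((n + 1)! : ℕ) p ∧ Continuous p} := fun i =>
    Nat.rec ⟨fun _ => ((n + 1)! : ℕ), isInflow_const (by positivity), continuous_const⟩
      (fun _ P => ⟨q P, ((hx P).isInflow P.2.1).congr (hq P), hqc P⟩) i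
  exact ⟨fun i => d (P i), fun i => (P i).1, fun i => x (P i), fun i => (P i).2.1,
    fun i => hx (P i), fun i => hdiff (P i), fun t => rfl, fun i t ht => hq (P i) t ht⟩

theorem exists_isNLSSolution (n : ℕ) :
    ∃ (θ : Fin (n + 1) → ℝ) (Y : Fin (n + 1) → ℝ → ℝ), IsNLSSolution (n + 1) θ Y ∧
      ∀ j, DifferentiableOn ℝ (Y j) (Ioo 0 1) := by
  obtain ⟨d, p, x, hp, hx, hdiff, hp0, hps⟩ := exists_chain n
  have hd : ∀ i, 0 < d i := fun i => (hx i).coeff_pos (hp i)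
  -- Chain index `i` stands for the component `j = n - i`, so `i = 0` is the last one. The product
  -- is chosen so that consecutive quotients of `ρ` return the factors `d`.
  let ρ : ℕ → ℝ := fun i => 1 / (((n + 1 : ℕ) : ℝ) * ∏ r ∈ Finset.range (i + 1), d r)
  have hprod : ∀ i, 0 < ∏ r ∈ Finset.range i, d r := fun i => Finset.prod_pos fun r _ => hd r
  have hρ : ∀ i, 0 < ρ i := fun i => by
    have := hprod (i + 1)
    positivity
  have hρ0 : 1 / (((n + 1 : ℕ) : ℝ) * ρ 0) = d 0 := by
    have := (hd 0).ne'
    simp only [ρ, zero_add, Finset.prod_range_one]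
    field_simp
  have hρs : ∀ i, ρ i / ρ (i + 1) = d (i + 1) := fun i => by
    have h1 := (hd (i + 1)).ne'
    have h2 := (hprod (i + 1)).ne'
    simp only [ρ]
    rw [Finset.prod_range_succ _ (i + 1)]
    field_simp
  have hlog : ∀ i t, -Real.log (Real.exp (-x i t)) = x i t := fun i t => by
    rw [Real.log_exp, neg_neg]
  refine ⟨fun j => ρ (n - j), fun j t => Real.exp (-x (n - j) t),
    { theta_ne_zero := fun j => (hρ _).ne'
      pos := fun j t _ => Real.exp_pos _
      continuousOn := fun j => (hx _).continuousOn.neg.rexp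
      ode_last := fun j hj t ht => ?_
      ode_step := fun j j' hj t ht => ?_
      init := fun j => by simp [(hx _).init]
      terminal := fun j => Real.tendsto_exp_neg_atTop_nhds_zero.comp (hx _).terminal },
    fun j => (hdiff _).neg.exp⟩
  · have hj0 : n - (j : ℕ) = 0 := by omega
    simp only [hlog, upperGamma_succ, hj0, hρ0]
    refine (((hx 0).ode t ht).const_sub (n ! : ℝ)).congr_deriv ?_
    rw [hp0]
    ring
  · have hjs : n - (j : ℕ) = n - (j' : ℕ) + 1 := by omega
    simp only [hlog, upperGamma_succ, hjs, hρs]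
    refine (((hx _).ode t ht).const_sub (n ! : ℝ)).congr_deriv ?_
    rw [hps _ t ht]
    ring

/-! ### Consequences for an arbitrary solution. -/

namespace IsNLSSolution

variable {n : ℕ} {θ : Fin (n + 1) → ℝ} {Y : Fin (n + 1) → ℝ → ℝ}

theorem isComponent_of_ode (h : IsNLSSolution (n + 1) θ Y) (j : Fin (n + 1)) {d : ℝ} {p : ℝ → ℝ}
    (hode : ∀ t ∈ Ico (0 : ℝ) 1,
      HasDerivWithinAt (fun s => upperGamma (n + 1) (-Real.log (Y j s)))
        (lowerGamma (n + 1) (-Real.log (Y j t)) - d * p t) (Ico 0 1) t) :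
    IsComponent n d p fun t => -Real.log (Y j t) where
  continuousOn := ((h.continuousOn j).log fun t ht => (h.pos j t ht).ne').neg
  init := by simp [h.init]
  terminal := by
    refine tendsto_neg_atBot_atTop.comp (Real.tendsto_log_nhdsGT_zero.comp
      (tendsto_nhdsWithin_iff.2 ⟨h.terminal j, ?_⟩))
    filter_upwards [Ico_mem_nhdsLT (zero_lt_one' ℝ)] with t ht using h.pos j t ht
  ode t ht := by
    have h1 := (hode t ht).const_sub (n ! : ℝ)
    simp only [upperGamma_succ, sub_sub_cancel, neg_sub] at h1
    exact h1

theorem isComponent_last (h : IsNLSSolution (n + 1) θ Y) {j : Fin (n + 1)}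
    (hj : (j : ℕ) + 1 = n + 1) :
    IsComponent n (1 / (((n + 1 : ℕ) : ℝ) * θ j)) (fun _ => ((n + 1)! : ℕ))
      fun t => -Real.log (Y j t) := by
  refine h.isComponent_of_ode j fun t ht => (h.ode_last j hj t ht).congr_deriv ?_
  rw [upperGamma_succ]
  ring

theorem isComponent_step (h : IsNLSSolution (n + 1) θ Y) {j j' : Fin (n + 1)}
    (hj : (j' : ℕ) = (j : ℕ) + 1) :
    IsComponent n (θ j' / θ j) (fun t => lowerGamma (n + 1) (-Real.log (Y j' t)))
      fun t => -Real.log (Y j t) := by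
  refine h.isComponent_of_ode j fun t ht => (h.ode_step j j' hj t ht).congr_deriv ?_
  rw [upperGamma_succ, upperGamma_succ]
  ring

/-- Downward induction on `j`: the last inflow is constant, and the outflow of component `j + 1` is
an admissible inflow for component `j`. -/
theorem exists_isComponent (h : IsNLSSolution (n + 1) θ Y) (j : Fin (n + 1)) :
    ∃ d p, IsInflow ((n + 1)! : ℕ) p ∧ IsComponent n d p fun t => -Real.log (Y j t) := by
  induction j using Fin.reverseInduction with
  | last => exact ⟨_, _, isInflow_const (by positivity), h.isComponent_last (by simp)⟩
  | cast i ih =>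
    obtain ⟨d, p, hp, hx⟩ := ih
    exact ⟨_, _, hx.isInflow hp, h.isComponent_step (by simp)⟩

theorem one_lt_div (h : IsNLSSolution (n + 1) θ Y) {j j' : Fin (n + 1)}
    (hj : (j' : ℕ) = (j : ℕ) + 1) : 1 < θ j' / θ j := by
  obtain ⟨d, p, hp, hx⟩ := h.exists_isComponent j'
  exact (h.isComponent_step hj).one_lt_coeff (hx.isInflow hp)

theorem theta_last (h : IsNLSSolution (n + 1) θ Y) :
    0 < θ (Fin.last n) ∧ θ (Fin.last n) < 1 / ((n + 1 : ℕ) : ℝ) := by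
  have h1 := (h.isComponent_last (j := Fin.last n) (by simp)).one_lt_coeff
    (isInflow_const (by positivity))
  have hn : (0 : ℝ) < ((n + 1 : ℕ) : ℝ) := by positivity
  have hmul : 0 < ((n + 1 : ℕ) : ℝ) * θ (Fin.last n) := one_div_pos.1 (one_pos.trans h1)
  refine ⟨pos_of_mul_pos_right hmul hn.le, ?_⟩
  rw [lt_div_iff₀ hn, mul_comm]
  rwa [lt_div_iff₀ hmul, one_mul] at h1

theorem theta_pos (h : IsNLSSolution (n + 1) θ Y) (j : Fin (n + 1)) : 0 < θ j := by
  induction j using Fin.reverseInduction with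
  | last => exact h.theta_last.1
  | cast i ih =>
    have h1 := one_pos.trans (h.one_lt_div (j := i.castSucc) (j' := i.succ) (by simp))
    exact (div_pos_iff_of_pos_left ih).1 h1

theorem strictMono_theta (h : IsNLSSolution (n + 1) θ Y) : StrictMono θ := by
  refine Fin.strictMono_iff_lt_succ.2 fun i => ?_
  have h1 := h.one_lt_div (j := i.castSucc) (j' := i.succ) (by simp)
  rwa [_root_.one_lt_div (h.theta_pos _)] at h1

theorem antitoneOn (h : IsNLSSolution (n + 1) θ Y) (j : Fin (n + 1)) :
    AntitoneOn (Y j) (Ico 0 1) := by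
  obtain ⟨d, p, hp, hx⟩ := h.exists_isComponent j
  intro s hs t ht hst
  have h1 := hx.monotoneOn hp hs ht hst
  simp only [neg_le_neg_iff] at h1
  exact (Real.log_le_log_iff (h.pos j t ht) (h.pos j s hs)).1 h1

end IsNLSSolution

theorem mainTheorem3 (k : ℕ) (hk : 0 < k) :
    (∃ (θ : Fin k → ℝ) (Y : Fin k → ℝ → ℝ), IsNLSSolution k θ Y ∧
      ∀ j, DifferentiableOn ℝ (Y j) (Ioo 0 1)) ∧
    ∀ (θ : Fin k → ℝ) (Y : Fin k → ℝ → ℝ), IsNLSSolution k θ Y →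
      (∀ j, 0 < θ j) ∧ StrictMono θ ∧ (∀ j, θ j < 1 / (k : ℝ)) ∧
      ∀ j, AntitoneOn (Y j) (Ico 0 1) := by
  obtain ⟨n, rfl⟩ := Nat.exists_eq_add_one.2 hk
  exact ⟨exists_isNLSSolution n, fun θ Y h => ⟨h.theta_pos, h.strictMono_theta,
    fun j => (h.strictMono_theta.monotone (Fin.le_last j)).trans_lt h.theta_last.2,
    h.antitoneOn⟩⟩
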